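/- **Setting.** Let $\mathcal M_1,\mathcal M_2$ be matroids on the same finite ground set $E$, $m=|E|$, and let $\mathrm{OPT}$ be a maximum-cardinality set that is independent in both. The elements of $E$ arrive one by one in an order $\pi$; an online algorithm knows $m$, and its irrevocable decisions on the first $k$ arriving elements may depend only on these elements, their order, which of their subsets are independent in $\mathcal M_1$ and in $\mathcal M_2$, and its own random bits. *Greedy* starts with $T=\emptyset$ and adds each arriving $e$ for which $T\cup\{e\}$ is independent in both matroids. Let $T_f^{\pi}$ be its set after the elements in positions $1\le i\le fm$, and let $\mathcal G(f)=\mathbb E_\pi[|T_f^{\pi}|]/|\mathrm{OPT}|$ for a uniformly random order $\pi$ (with $\mathcal G(f)=0$ if $\mathrm{OPT}=\emptyset$). **Marking-Greedy**, with parameters $f,p\in(0,1)$, uses independent bits $\Psi(e)$, $e\in E$, also independent of $\pi$, with $\Pr[\Psi(e)=1]=1-p$. * *Phase (a)*, elements in positions $i\le fm$: start with $S=T=\emptyset$. When $e$ arrives and $T\cup\{e\}$ is independent in both matroids, add $e$ to $T$, and if moreover $\Psi(e)=1$, add $e$ to $S$. * *Phase (b)*, elements in positions $i>fm$: let $T_f$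 be the final $T$, and start with $N_1=N_2=\emptyset$. When $e$ arrives, do the following for $(i,j)=(1,2)$ and $(i,j)=(2,1)$: if $e\in\mathrm{span}_i(T_f)$, $e\notin\mathrm{span}_j(T_f)$, $S\cup N_i\cup\{e\}$ is independent in $\mathcal M_i$ and $T_f\cup N_i\cup\{e\}$ is independent in $\mathcal M_j$, add $e$ to $N_i$. Here $\mathrm{span}_i$ is the closure operator of $\mathcal M_i$. * Output $S\cup N_1\cup N_2$. **Theorem.** There are universal constants $\varepsilon,\gamma>0$ and $f,p\in(0,1)$, namely $\varepsilon=0.001$, $f=0.05$, $p=0.33$ and some $\gamma\ge 0.03$, such that Marking-Greedy with parameters $f,p$ is a randomized online algorithm and the following holds for any two matroids $\mathcal M_1,\mathcal M_2$ on the same finite ground set. If $\mathcal G(1)\le \frac12+\varepsilon$, then Marking-Greedy always outputs a set that is independent in both matroids, and $$\mathbb E_{\pi,\Psi}\big[|S\cup N_1\cup N_2|\big]\ \ge\ \Big(\tfrac12+\gamma\Big)\,|\mathrm{OPT}| ,$$ where $\pi$ is a uniformly random order. -/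

import Mathlib

open scoped BigOperators

namespace OnlineMatroidIntersection

noncomputable section

open Classical in
/-- One step of Greedy: select the arriving element `e` if `T ∪ e` stays independent in both
matroids. -/
def greedyStep {α : Type*} (M₁ M₂ : Matroid α) (T : Finset α) (e : α) : Finset α :=
  if M₁.Indep (insert e (T : Set α)) ∧ M₂.Indep (insert e (T : Set α)) then insert e T else T

/-- Greedy on the elements of `l`, in this order. -/
def greedy {α : Type*} (M₁ M₂ : Matroid α) (l : List α) : Finset α :=
  l.foldl (greedyStep M₁ M₂) ∅

open Classical in
/-- One step of Phase (a). The state is `(T, S)`: the elements selected by Greedy, and those among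
them that are picked into the final solution. -/
def phaseAStep {α : Type*} (M₁ M₂ : Matroid α) (Ψ : α → Bool)
    (TS : Finset α × Finset α) (e : α) : Finset α × Finset α :=
  if M₁.Indep (insert e (TS.1 : Set α)) ∧ M₂.Indep (insert e (TS.1 : Set α)) then
    (insert e TS.1, if Ψ e = true then insert e TS.2 else TS.2)
  else TS

open Classical in
/-- The Greedy step of Phase (b) on `Mᵢ / S` and `Mⱼ / T`, for elements that lie in the span of `T`
in `Mᵢ` but not in `Mⱼ`. -/
def augmentStep {α : Type*} (Mi Mj : Matroid α) (T S N : Finset α) (e : α) : Finset α :=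
  if (e ∈ Mi.closure (T : Set α) ∧ e ∉ Mj.closure (T : Set α)) ∧
      (Mi.Indep (insert e ((S : Set α) ∪ N)) ∧ Mj.Indep (insert e ((T : Set α) ∪ N))) then
    insert e N
  else N

/-- One step of Phase (b). The state is `(N₁, N₂)`. -/
def phaseBStep {α : Type*} (M₁ M₂ : Matroid α) (T S : Finset α)
    (N : Finset α × Finset α) (e : α) : Finset α × Finset α :=
  (augmentStep M₁ M₂ T S N.1 e, augmentStep M₂ M₁ T S N.2 e)

/-- An arrival order of the elements of `α`: `π i` is the element in position `i + 1`. -/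
abbrev ArrivalOrder (α : Type*) [Fintype α] : Type _ := Fin (Fintype.card α) ≃ α

/-- The first `f`-fraction of the elements: those in the positions `1 ≤ i ≤ f m`. -/
def firstPart {α : Type*} [Fintype α] (f : ℝ) (π : ArrivalOrder α) : List α :=
  (List.ofFn π).take ⌊f * (Fintype.card α : ℝ)⌋₊

/-- The remaining elements: those in the positions `f m < i ≤ m`. -/
def secondPart {α : Type*} [Fintype α] (f : ℝ) (π : ArrivalOrder α) : List α :=
  (List.ofFn π).drop ⌊f * (Fintype.card α : ℝ)⌋₊

open Classical in
/-- The output `S ∪ N₁ ∪ N₂` of Marking-Greedy with phase parameter `f` and auxiliary bits `Ψ`. -/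
def markingGreedy {α : Type*} [Fintype α] (f : ℝ) (Ψ : α → Bool) (M₁ M₂ : Matroid α)
    (π : ArrivalOrder α) : Finset α :=
  let TS := (firstPart f π).foldl (phaseAStep M₁ M₂ Ψ) (∅, ∅)
  let N := (secondPart f π).foldl (phaseBStep M₁ M₂ TS.1 TS.2) (∅, ∅)
  TS.2 ∪ N.1 ∪ N.2

/-- `O` is a common independent set of maximum cardinality. -/
def IsMaxCommonIndep {α : Type*} (M₁ M₂ : Matroid α) (O : Finset α) : Prop :=
  (M₁.Indep (O : Set α) ∧ M₂.Indep (O : Set α)) ∧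
    ∀ I : Finset α, M₁.Indep (I : Set α) → M₂.Indep (I : Set α) → I.card ≤ O.card

open Classical in
/-- `𝒢(f)`: the expected size, over a uniformly random arrival order, of the Greedy solution after
the first `f`-fraction of the elements, divided by the size of `O`. -/
def greedyRatio {α : Type*} [Fintype α] (M₁ M₂ : Matroid α) (O : Finset α) (f : ℝ) : ℝ :=
  (Finset.expect Finset.univ fun π : ArrivalOrder α =>
    ((greedy M₁ M₂ (firstPart f π)).card : ℝ)) / (O.card : ℝ)

/-- The probability of `Ψ` when the bits `Ψ e` are independent and each is `1` with
probability `1 - p`. -/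
def bitsProb {α : Type*} [Fintype α] (p : ℝ) (Ψ : α → Bool) : ℝ :=
  ∏ e, if Ψ e = true then 1 - p else p

open Classical in
/-- The expected output size of Marking-Greedy, over a uniformly random arrival order and
independent auxiliary bits with `Pr[Ψ e = 1] = 1 - p`. -/
def markingGreedyExpectedSize {α : Type*} [Fintype α] (M₁ M₂ : Matroid α) (f p : ℝ) : ℝ :=
  Finset.expect Finset.univ fun π : ArrivalOrder α =>
    ∑ Ψ : α → Bool, bitsProb p Ψ * ((markingGreedy f Ψ M₁ M₂ π).card : ℝ)

open Classical in
/-- The set of the first `k` elements to arrive. -/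
def arrived {α : Type*} [Fintype α] (π : ArrivalOrder α) (k : ℕ) : Finset α :=
  Finset.univ.filter fun e => (π.symm e : ℕ) < k

open Classical in
/-- `A` is an online algorithm: its (irrevocable) decisions on the first `k` arriving elements depend
only on these elements, their order, and which of their subsets are independent in each of the
matroids (besides the number of elements, which is known in advance). -/
def IsOnline {α : Type*} [Fintype α]
    (A : Matroid α → Matroid α → ArrivalOrder α → Finset α) : Prop :=
  ∀ (k : ℕ) (M₁ M₂ M₁' M₂' : Matroid α) (π π' : ArrivalOrder α),
    M₁.E = Set.univ → M₂.E = Set.univ → M₁'.E = Set.univ → M₂'.E = Set.univ →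
    (∀ i : Fin (Fintype.card α), (i : ℕ) < k → π i = π' i) →
    (∀ I ⊆ arrived π k, (M₁.Indep (I : Set α) ↔ M₁'.Indep (I : Set α)) ∧
      (M₂.Indep (I : Set α) ↔ M₂'.Indep (I : Set α))) →
    A M₁ M₂ π ∩ arrived π k = A M₁' M₂' π' ∩ arrived π k

end

end OnlineMatroidIntersection

open scoped BigOperators

namespace OnlineMatroidIntersection

open Classical

/-! ### Spans and independence in a single matroid. -/

section MatroidFacts

variable {α : Type*} {M : Matroid α}

/-! Write `O` for the optimum, `T` for the Greedy set after the first phase, `U` for the part of `O`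
that `T` spans in neither matroid, and `c = p / (1 + p)`.

If Greedy barely beats one half, it is stuck early. The final Greedy set spans each element of `O`
in some matroid, and those it contains in both, so `|O| + |O ∩ greedy| ≤ 2 |greedy|`; hence Greedy
picks at most `2ε|O|` elements of `O` on average. An element still unspanned after the first phase
would have been picked had it arrived at any earlier position, so exchanging positions gives `f ·
E|U| ≤ 2ε|O|` (`mul_sum_card_unspanned_le`). Thus `T`, already of expected size at least about
`|O|/2`, leaves little of `O` unspanned, and only an `f`-fraction of `O` has been seen.

Keeping each element of `T` with probability `1 - p` frees room for elements of `O` spanned in one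
matroid only. Within these, `exists_candidates` finds sets `I₁`, `I₂` of total size at least `2|O| -
2|T| - 2|U|`, less the early part of `O`. By `sampling`, each subroutine of the second phase gains
`c |Iᵢ|` in expectation. For a fixed order the output therefore has expected size at least `(1 - p -
2c)|T| + c (2|O| - 2|U| - early)`; averaging over orders, with `|T| ≥ (|O| - |U|)/2`, yields the
bound. -/

theorem mem_closure_sdiff_of_forall_mem {B : Set α} (hB : M.Indep B) {e : α}
    (he : e ∈ M.closure B) (U : Finset α) (hU : ∀ u ∈ U, e ∈ M.closure (B \ {u})) :
    e ∈ M.closure (B \ U) := by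
  induction U using Finset.induction_on with
  | empty => simpa using he
  | insert u U hu ih =>
    have h1 := ih fun v hv => hU v (Finset.mem_insert_of_mem hv)
    have h2 := hU u (Finset.mem_insert_self u U)
    have h3 : B \ ((insert u U : Finset α) : Set α) = (B \ U) ∩ (B \ {u}) := by
      ext x
      simp only [Finset.coe_insert, Set.mem_sdiff, Set.mem_insert_iff, Set.mem_inter_iff,
        Set.mem_singleton_iff]
      tauto
    rw [h3, Matroid.Indep.closure_inter_eq_inter_closure
      (hB.subset (Set.union_subset Set.sdiff_subset Set.sdiff_subset))]
    exact ⟨h1, h2⟩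

theorem mem_closure_of_not_indep_insert (hE : M.E = Set.univ) {T : Set α} (hT : M.Indep T)
    {e : α} (he : ¬ M.Indep (insert e T)) : e ∈ M.closure T :=
  hT.mem_closure_iff'.2 ⟨by simp [hE], fun h => absurd h he⟩

theorem indep_insert_of_notMem_closure (hE : M.E = Set.univ) {T : Set α} (hT : M.Indep T)
    {e : α} (he : e ∉ M.closure T) : M.Indep (insert e T) := by
  by_contra h
  exact he (mem_closure_of_not_indep_insert hE hT h)

theorem mem_closure_of_mem (hE : M.E = Set.univ) {T : Set α} {e : α} (he : e ∈ T) :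
    e ∈ M.closure T :=
  M.subset_closure T (by simp [hE]) he

theorem mem_of_indep_insert_of_mem_closure {T : Set α} {e : α}
    (h : M.Indep (insert e T)) (he : e ∈ M.closure T) : e ∈ T :=
  ((h.subset (Set.subset_insert e T)).mem_closure_iff'.1 he).2 h

theorem card_le_of_indep_of_subset_closure {I X : Finset α} (hI : M.Indep (I : Set α))
    (hX : (I : Set α) ⊆ M.closure X) : I.card ≤ X.card := by
  have h1 := hI.encard_le_eRk_of_subset hX
  rw [M.eRk_closure_eq] at h1
  have h2 := h1.trans (M.eRk_le_encard X)
  simpa using h2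

/-- A set that is independent in the contraction by `T` stays independent over any independent
subset of the span of `T`. -/
theorem indep_union_of_subset_closure (hE : M.E = Set.univ) {X T : Set α} (hX : M.Indep X)
    (hXT : X ⊆ M.closure T) (Y : Finset α) (hY : M.Indep (T ∪ Y)) (hd : ∀ y ∈ Y, y ∉ T) :
    M.Indep (X ∪ Y) := by
  induction Y using Finset.induction_on with
  | empty => simpa using hX
  | insert y Y hy ih =>
    have hTY : M.Indep (T ∪ Y) := hY.subset (by
      rw [Finset.coe_insert]; exact Set.union_subset_union_right _ (Set.subset_insert _ _))
    have h1 := ih hTY fun z hz => hd z (Finset.mem_insert_of_mem hz)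
    rw [Finset.coe_insert, Set.union_insert] at hY ⊢
    refine indep_insert_of_notMem_closure hE h1 fun hcl => ?_
    have h2 : M.closure (X ∪ Y) ⊆ M.closure (T ∪ Y) := by
      apply M.closure_subset_closure_of_subset_closure
      rintro x (hx | hx)
      · exact M.closure_subset_closure Set.subset_union_left (hXT hx)
      · exact mem_closure_of_mem hE (Or.inr hx)
    rcases mem_of_indep_insert_of_mem_closure hY (h2 hcl) with h | h
    · exact hd y (Finset.mem_insert_self y Y) h
    · exact hy h

/-- Extend `T` to a basis of `T ∪ O` and take `J` to be the new elements; the basis spans `O`, so it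
has at least `|O|` elements. -/
theorem exists_indep_augmentation [Fintype α] (hE : M.E = Set.univ) {T O : Finset α}
    (hT : M.Indep (T : Set α)) (hO : M.Indep (O : Set α)) :
    ∃ J ⊆ O, (∀ e ∈ J, e ∉ M.closure (T : Set α)) ∧ M.Indep ((T : Set α) ∪ J) ∧
      O.card ≤ T.card + J.card := by
  obtain ⟨B, hB, hTB⟩ := hT.subset_isBasis_of_subset
    (X := (T : Set α) ∪ O) Set.subset_union_left (by simp [hE])
  have hJ : ((T : Set α) ∪ ((B.toFinset \ T : Finset α) : Set α)) = B := by
    ext x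
    simp only [Finset.coe_sdiff, Set.coe_toFinset, Set.mem_union, Set.mem_sdiff]
    constructor
    · rintro (h | h)
      · exact hTB h
      · exact h.1
    · tauto
  refine ⟨B.toFinset \ T, ?_, ?_, ?_, ?_⟩
  · intro x hx
    simp only [Finset.mem_sdiff, Set.mem_toFinset] at hx
    rcases hB.subset hx.1 with h | h
    · exact absurd h hx.2
    · exact h
  · intro e he hcl
    simp only [Finset.mem_sdiff, Set.mem_toFinset] at he
    exact he.2 (mem_of_indep_insert_of_mem_closure
      (hB.indep.subset (Set.insert_subset he.1 hTB)) hcl)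
  · rw [hJ]; exact hB.indep
  · have h1 : O.card ≤ (B.toFinset).card := by
      refine card_le_of_indep_of_subset_closure hO fun x hx => ?_
      rw [Set.coe_toFinset]
      exact hB.subset_closure (Or.inr hx)
    have h2 : (B.toFinset \ T).card + T.card = B.toFinset.card :=
      Finset.card_sdiff_add_card_eq_card (by
        intro x hx; simpa using hTB hx)
    omega

end MatroidFacts

/-! ### Greedy and the decomposition of the two phases. -/

section Greedy

variable {α : Type*} {M₁ M₂ : Matroid α}

theorem subset_greedyStep (T : Finset α) (e : α) : T ⊆ greedyStep M₁ M₂ T e := by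
  unfold greedyStep
  split_ifs
  · exact Finset.subset_insert e T
  · exact subset_rfl

theorem subset_foldl_greedyStep (l : List α) (T : Finset α) :
    T ⊆ l.foldl (greedyStep M₁ M₂) T := by
  induction l generalizing T with
  | nil => exact subset_rfl
  | cons e l ih => exact (subset_greedyStep T e).trans (ih _)

theorem mem_of_mem_foldl_greedyStep (l : List α) (T : Finset α) {x : α}
    (hx : x ∈ l.foldl (greedyStep M₁ M₂) T) : x ∈ T ∨ x ∈ l := by
  induction l generalizing T with
  | nil => exact Or.inl hx
  | cons e l ih =>
    rcases ih _ hx with h | h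
    · unfold greedyStep at h
      split_ifs at h
      · rcases Finset.mem_insert.1 h with rfl | h
        · simp
        · exact Or.inl h
      · exact Or.inl h
    · exact Or.inr (List.mem_cons_of_mem _ h)

theorem indep_foldl_greedyStep (l : List α) (T : Finset α)
    (h : M₁.Indep (T : Set α) ∧ M₂.Indep (T : Set α)) :
    M₁.Indep ((l.foldl (greedyStep M₁ M₂) T : Finset α) : Set α) ∧
      M₂.Indep ((l.foldl (greedyStep M₁ M₂) T : Finset α) : Set α) := by
  induction l generalizing T with
  | nil => exact h
  | cons e l ih =>
    refine ih _ ?_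
    unfold greedyStep
    split_ifs with h'
    · simpa using h'
    · exact h

theorem indep_greedy (l : List α) :
    M₁.Indep (greedy M₁ M₂ l : Set α) ∧ M₂.Indep (greedy M₁ M₂ l : Set α) :=
  indep_foldl_greedyStep l ∅ (by simp)

theorem mem_of_mem_greedy {l : List α} {x : α} (hx : x ∈ greedy M₁ M₂ l) : x ∈ l := by
  simpa using mem_of_mem_foldl_greedyStep l ∅ hx

theorem greedy_append (l₁ l₂ : List α) :
    greedy M₁ M₂ (l₁ ++ l₂) = l₂.foldl (greedyStep M₁ M₂) (greedy M₁ M₂ l₁) :=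
  List.foldl_append

theorem greedy_subset_greedy_append (l₁ l₂ : List α) :
    greedy M₁ M₂ l₁ ⊆ greedy M₁ M₂ (l₁ ++ l₂) := by
  rw [greedy_append]
  exact subset_foldl_greedyStep _ _

theorem mem_greedy_of_notMem_closure (h₁ : M₁.E = Set.univ) (h₂ : M₂.E = Set.univ)
    (l₁ l₂ : List α) {e : α} (he₁ : e ∉ M₁.closure (greedy M₁ M₂ l₁ : Set α))
    (he₂ : e ∉ M₂.closure (greedy M₁ M₂ l₁ : Set α)) :
    e ∈ greedy M₁ M₂ (l₁ ++ e :: l₂) := by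
  rw [greedy_append, List.foldl_cons]
  apply subset_foldl_greedyStep
  unfold greedyStep
  rw [if_pos ⟨indep_insert_of_notMem_closure h₁ (indep_greedy l₁).1 he₁,
    indep_insert_of_notMem_closure h₂ (indep_greedy l₁).2 he₂⟩]
  exact Finset.mem_insert_self _ _

/-- An element spanned in neither matroid at the end was spanned in neither when it arrived, so it
would have been taken, and then it would be spanned. -/
theorem mem_closure_greedy (h₁ : M₁.E = Set.univ) (h₂ : M₂.E = Set.univ) {l : List α} {e : α}
    (he : e ∈ l) : e ∈ M₁.closure (greedy M₁ M₂ l : Set α) ∨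
      e ∈ M₂.closure (greedy M₁ M₂ l : Set α) := by
  obtain ⟨l₁, l₂, rfl⟩ := List.append_of_mem he
  by_contra! hcon
  have hsub : (greedy M₁ M₂ l₁ : Set α) ⊆ greedy M₁ M₂ (l₁ ++ e :: l₂) := by
    exact_mod_cast greedy_subset_greedy_append l₁ (e :: l₂)
  refine hcon.1 (mem_closure_of_mem h₁ ?_)
  exact_mod_cast mem_greedy_of_notMem_closure h₁ h₂ l₁ l₂
    (fun h => hcon.1 (M₁.closure_subset_closure hsub h))
    (fun h => hcon.2 (M₂.closure_subset_closure hsub h))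

/-- The bits never influence `T`: it depends on the order alone, and `S` is a random subset of it.
This lets the order be fixed first and the bits averaged afterwards. -/
theorem foldl_phaseAStep_eq (Ψ : α → Bool) (l : List α) (T : Finset α) :
    l.foldl (phaseAStep M₁ M₂ Ψ) (T, T.filter fun e => Ψ e = true) =
      (l.foldl (greedyStep M₁ M₂) T,
        (l.foldl (greedyStep M₁ M₂) T).filter fun e => Ψ e = true) := by
  induction l generalizing T with
  | nil => rfl
  | cons e l ih =>
    rw [List.foldl_cons, List.foldl_cons, ← ih]
    congr 1
    unfold phaseAStep greedyStep
    split_ifs <;> simp [Finset.filter_insert, *]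

theorem foldl_phaseBStep_eq (T S : Finset α) (l : List α) (N : Finset α × Finset α) :
    l.foldl (phaseBStep M₁ M₂ T S) N =
      (l.foldl (augmentStep M₁ M₂ T S) N.1, l.foldl (augmentStep M₂ M₁ T S) N.2) := by
  induction l generalizing N with
  | nil => rfl
  | cons e l ih => rw [List.foldl_cons, ih]; rfl

/-- The elements that the Greedy subroutine on `Mᵢ / S` and `Mⱼ / T` of Phase (b) selects. -/
noncomputable def augment (Mi Mj : Matroid α) (T S : Finset α) (l : List α) : Finset α :=
  l.foldl (augmentStep Mi Mj T S) ∅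

theorem markingGreedy_eq [Fintype α] (f : ℝ) (Ψ : α → Bool) (π : ArrivalOrder α) :
    markingGreedy f Ψ M₁ M₂ π =
      (greedy M₁ M₂ (firstPart f π)).filter (fun e => Ψ e = true) ∪
      augment M₁ M₂ (greedy M₁ M₂ (firstPart f π))
        ((greedy M₁ M₂ (firstPart f π)).filter fun e => Ψ e = true) (secondPart f π) ∪
      augment M₂ M₁ (greedy M₁ M₂ (firstPart f π))
        ((greedy M₁ M₂ (firstPart f π)).filter fun e => Ψ e = true) (secondPart f π) := by
  have h : (firstPart f π).foldl (phaseAStep M₁ M₂ Ψ) (∅, ∅) =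
      (greedy M₁ M₂ (firstPart f π),
        (greedy M₁ M₂ (firstPart f π)).filter fun e => Ψ e = true) :=
    foldl_phaseAStep_eq Ψ _ ∅
  simp only [markingGreedy, h, foldl_phaseBStep_eq]
  rfl

end Greedy

/-! ### The second phase: feasibility and size of the output. -/

section Augment

variable {α : Type*} {Mi Mj : Matroid α} {T S : Finset α}

theorem foldl_augmentStep_spec (l : List α) (N : Finset α)
    (hi : Mi.Indep ((S : Set α) ∪ N)) (hj : Mj.Indep ((T : Set α) ∪ N))
    (hN : ∀ x ∈ N, x ∈ Mi.closure (T : Set α) ∧ x ∉ Mj.closure (T : Set α)) :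
    Mi.Indep ((S : Set α) ∪ (l.foldl (augmentStep Mi Mj T S) N : Finset α)) ∧
      Mj.Indep ((T : Set α) ∪ (l.foldl (augmentStep Mi Mj T S) N : Finset α)) ∧
      ∀ x ∈ l.foldl (augmentStep Mi Mj T S) N,
        x ∈ Mi.closure (T : Set α) ∧ x ∉ Mj.closure (T : Set α) := by
  induction l generalizing N with
  | nil => exact ⟨hi, hj, hN⟩
  | cons e l ih =>
    rw [List.foldl_cons]
    by_cases h : (e ∈ Mi.closure (T : Set α) ∧ e ∉ Mj.closure (T : Set α)) ∧
      (Mi.Indep (insert e ((S : Set α) ∪ N)) ∧ Mj.Indep (insert e ((T : Set α) ∪ N)))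
    · have hs : augmentStep Mi Mj T S N e = insert e N := if_pos h
      rw [hs]
      refine ih _ ?_ ?_ ?_
      · rw [Finset.coe_insert, Set.union_insert]; exact h.2.1
      · rw [Finset.coe_insert, Set.union_insert]; exact h.2.2
      · intro x hx
        rcases Finset.mem_insert.1 hx with rfl | hx
        · exact h.1
        · exact hN x hx
    · have hs : augmentStep Mi Mj T S N e = N := if_neg h
      rw [hs]
      exact ih N hi hj hN

theorem augment_spec (l : List α) (hi : Mi.Indep (S : Set α)) (hj : Mj.Indep (T : Set α)) :
    Mi.Indep ((S : Set α) ∪ augment Mi Mj T S l) ∧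
      Mj.Indep ((T : Set α) ∪ augment Mi Mj T S l) ∧
      ∀ x ∈ augment Mi Mj T S l, x ∈ Mi.closure (T : Set α) ∧ x ∉ Mj.closure (T : Set α) :=
  foldl_augmentStep_spec l ∅ (by simpa using hi) (by simpa using hj) (by simp)

/-- In `Mi`, the second augmentation is independent over all of `T`, while `S` and the first
augmentation lie in the span of `T`; so the two cannot conflict. -/
theorem indep_union_augment (hEi : Mi.E = Set.univ) (hS : S ⊆ T)
    (hi : Mi.Indep (T : Set α)) (hj : Mj.Indep (T : Set α)) (l l' : List α) :
    Mi.Indep (((S : Set α) ∪ augment Mi Mj T S l) ∪ augment Mj Mi T S l') := by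
  have hS' : (S : Set α) ⊆ T := by exact_mod_cast hS
  obtain ⟨a1, a2, a3⟩ := augment_spec (T := T) l (hi.subset hS') hj
  obtain ⟨b1, b2, b3⟩ := augment_spec (T := T) l' (hj.subset hS') hi
  refine indep_union_of_subset_closure hEi a1 (T := T) ?_ _ b2 ?_
  · rintro x (hx | hx)
    · exact mem_closure_of_mem hEi (hS' hx)
    · exact (a3 x hx).1
  · exact fun y hy hyT => (b3 y hy).2 (mem_closure_of_mem hEi hyT)

/-- The three pieces are disjoint: `S` is spanned by `T` in both matroids, and each augmentation in
exactly one, a different one for each. -/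
theorem card_union_augment (hEi : Mi.E = Set.univ) (hEj : Mj.E = Set.univ) (hS : S ⊆ T)
    (hi : Mi.Indep (T : Set α)) (hj : Mj.Indep (T : Set α)) (l l' : List α) :
    (S ∪ augment Mi Mj T S l ∪ augment Mj Mi T S l').card =
      S.card + (augment Mi Mj T S l).card + (augment Mj Mi T S l').card := by
  have hS' : (S : Set α) ⊆ T := by exact_mod_cast hS
  obtain ⟨a1, a2, a3⟩ := augment_spec (T := T) l (hi.subset hS') hj
  obtain ⟨b1, b2, b3⟩ := augment_spec (T := T) l' (hj.subset hS') hi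
  rw [Finset.card_union_of_disjoint, Finset.card_union_of_disjoint]
  · rw [Finset.disjoint_left]
    exact fun x hx hx' => (a3 x hx').2 (mem_closure_of_mem hEj (hS' hx))
  · rw [Finset.disjoint_left]
    intro x hx hx'
    rcases Finset.mem_union.1 hx with h | h
    · exact (b3 x hx').2 (mem_closure_of_mem hEi (hS' h))
    · exact (b3 x hx').2 (a3 x h).1

theorem markingGreedy_indep {α : Type*} [Fintype α] {M₁ M₂ : Matroid α} (h₁ : M₁.E = Set.univ)
    (h₂ : M₂.E = Set.univ) (f : ℝ) (Ψ : α → Bool) (π : ArrivalOrder α) :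
    M₁.Indep (markingGreedy f Ψ M₁ M₂ π : Set α) ∧
      M₂.Indep (markingGreedy f Ψ M₁ M₂ π : Set α) := by
  rw [markingGreedy_eq]
  obtain ⟨g₁, g₂⟩ := indep_greedy (M₁ := M₁) (M₂ := M₂) (firstPart f π)
  rw [Finset.coe_union, Finset.coe_union]
  constructor
  · exact indep_union_augment h₁ (Finset.filter_subset _ _) g₁ g₂ _ _
  · rw [Set.union_right_comm]
    exact indep_union_augment h₂ (Finset.filter_subset _ _) g₂ g₁ _ _

end Augment

/-! ### The online property. -/

section Online

variable {α : Type*}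

theorem foldl_greedyStep_inter (M₁ M₂ : Matroid α) (X : Finset α) (l : List α) (T : Finset α)
    (hl : ∀ x ∈ l, x ∉ X) : l.foldl (greedyStep M₁ M₂) T ∩ X = T ∩ X := by
  induction l generalizing T with
  | nil => rfl
  | cons e l ih =>
    rw [List.foldl_cons, ih _ fun x hx => hl x (List.mem_cons_of_mem _ hx)]
    unfold greedyStep
    split_ifs
    · exact Finset.insert_inter_of_notMem (hl e List.mem_cons_self)
    · rfl

theorem foldl_augmentStep_inter (Mi Mj : Matroid α) (T S X : Finset α) (l : List α)
    (N : Finset α) (hl : ∀ x ∈ l, x ∉ X) : l.foldl (augmentStep Mi Mj T S) N ∩ X = N ∩ X := by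
  induction l generalizing N with
  | nil => rfl
  | cons e l ih =>
    rw [List.foldl_cons, ih _ fun x hx => hl x (List.mem_cons_of_mem _ hx)]
    unfold augmentStep
    split_ifs
    · exact Finset.insert_inter_of_notMem (hl e List.mem_cons_self)
    · rfl

/-- Two matroids have the same independent subsets of `X`. -/
def AgreeOn (X : Finset α) (M M' : Matroid α) : Prop :=
  ∀ I ⊆ X, M.Indep (I : Set α) ↔ M'.Indep (I : Set α)

variable {X : Finset α} {M₁ M₂ M₁' M₂' : Matroid α}

theorem AgreeOn.mem_closure_iff (h : AgreeOn X M₁ M₁') (hE : M₁.E = Set.univ)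
    (hE' : M₁'.E = Set.univ) {T : Finset α} (hT : T ⊆ X) (hi : M₁.Indep (T : Set α)) {e : α}
    (he : e ∈ X) : e ∈ M₁.closure (T : Set α) ↔ e ∈ M₁'.closure (T : Set α) := by
  have h1 := h (insert e T) (Finset.insert_subset he hT)
  rw [Finset.coe_insert] at h1
  rw [hi.mem_closure_iff', ((h T hT).1 hi).mem_closure_iff', h1, hE, hE']

theorem foldl_greedyStep_congr (h₁ : AgreeOn X M₁ M₁') (h₂ : AgreeOn X M₂ M₂') (l : List α)
    (T : Finset α) (hT : T ⊆ X) (hl : ∀ x ∈ l, x ∈ X) :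
    l.foldl (greedyStep M₁ M₂) T = l.foldl (greedyStep M₁' M₂') T := by
  induction l generalizing T with
  | nil => rfl
  | cons e l ih =>
    have he : insert e T ⊆ X := Finset.insert_subset (hl e List.mem_cons_self) hT
    have a1 := h₁ _ he
    have a2 := h₂ _ he
    rw [Finset.coe_insert] at a1 a2
    have hs : greedyStep M₁ M₂ T e = greedyStep M₁' M₂' T e := by
      unfold greedyStep
      rw [a1, a2]
    have hX : greedyStep M₁' M₂' T e ⊆ X := by
      unfold greedyStep
      split_ifs <;> assumption
    rw [List.foldl_cons, List.foldl_cons, hs]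
    exact ih _ hX fun x hx => hl x (List.mem_cons_of_mem _ hx)

theorem foldl_augmentStep_congr (h₁ : AgreeOn X M₁ M₁') (h₂ : AgreeOn X M₂ M₂')
    (hE₁ : M₁.E = Set.univ) (hE₂ : M₂.E = Set.univ) (hE₁' : M₁'.E = Set.univ)
    (hE₂' : M₂'.E = Set.univ) {T S : Finset α} (hT : T ⊆ X) (hS : S ⊆ X)
    (hi₁ : M₁.Indep (T : Set α)) (hi₂ : M₂.Indep (T : Set α)) (l : List α)
    (N : Finset α) (hN : N ⊆ X) (hl : ∀ x ∈ l, x ∈ X) :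
    l.foldl (augmentStep M₁ M₂ T S) N = l.foldl (augmentStep M₁' M₂' T S) N := by
  induction l generalizing N with
  | nil => rfl
  | cons e l ih =>
    have he : e ∈ X := hl e List.mem_cons_self
    have a1 := h₁ (insert e (S ∪ N)) (Finset.insert_subset he (Finset.union_subset hS hN))
    have a2 := h₂ (insert e (T ∪ N)) (Finset.insert_subset he (Finset.union_subset hT hN))
    rw [Finset.coe_insert, Finset.coe_union] at a1 a2
    have hs : augmentStep M₁ M₂ T S N e = augmentStep M₁' M₂' T S N e := by
      unfold augmentStep
      rw [a1, a2, h₁.mem_closure_iff hE₁ hE₁' hT hi₁ he, h₂.mem_closure_iff hE₂ hE₂' hT hi₂ he]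
    have hX : augmentStep M₁' M₂' T S N e ⊆ X := by
      unfold augmentStep
      split_ifs
      · exact Finset.insert_subset he hN
      · exact hN
    rw [List.foldl_cons, List.foldl_cons, hs]
    exact ih _ hX fun x hx => hl x (List.mem_cons_of_mem _ hx)

variable [Fintype α]

theorem mem_take_ofFn (π : ArrivalOrder α) (k : ℕ) (e : α) :
    e ∈ (List.ofFn π).take k ↔ (π.symm e : ℕ) < k := by
  rw [List.mem_take_iff_getElem]
  simp only [List.length_ofFn, List.getElem_ofFn, lt_min_iff]
  constructor
  · rintro ⟨i, hi, rfl⟩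
    simpa using hi.1
  · intro h
    exact ⟨π.symm e, ⟨h, (π.symm e).2⟩, by simp⟩

theorem mem_drop_ofFn (π : ArrivalOrder α) (k : ℕ) (e : α) :
    e ∈ (List.ofFn π).drop k ↔ k ≤ (π.symm e : ℕ) := by
  rw [List.mem_drop_iff_getElem]
  simp only [List.length_ofFn, List.getElem_ofFn]
  constructor
  · rintro ⟨i, hi, rfl⟩
    simp
  · intro h
    exact ⟨π.symm e - k, by have := (π.symm e).2; omega, by simp [h]⟩

theorem mem_arrived (π : ArrivalOrder α) (k : ℕ) (e : α) :
    e ∈ arrived π k ↔ (π.symm e : ℕ) < k := by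
  simp [arrived]

theorem take_ofFn_congr {π π' : ArrivalOrder α} {k : ℕ}
    (h : ∀ i : Fin (Fintype.card α), (i : ℕ) < k → π i = π' i) :
    (List.ofFn π).take k = (List.ofFn π').take k := by
  apply List.ext_getElem
  · simp
  · intro i h1 h2
    simp only [List.length_take, List.length_ofFn, lt_min_iff] at h1
    simpa using h ⟨i, h1.2⟩ h1.1

theorem greedy_firstPart_inter_arrived (M₁ M₂ : Matroid α) (f : ℝ) (π : ArrivalOrder α) (k : ℕ) :
    greedy M₁ M₂ (firstPart f π) ∩ arrived π k =
      greedy M₁ M₂ (((List.ofFn π).take k).take ⌊f * (Fintype.card α : ℝ)⌋₊) ∩ arrived π k := by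
  set n := ⌊f * (Fintype.card α : ℝ)⌋₊
  have h : firstPart f π = ((List.ofFn π).take k).take n ++ ((List.ofFn π).take n).drop k := by
    rw [List.take_take, min_comm, ← List.take_take, List.take_append_drop]
    rfl
  rw [h, greedy_append, foldl_greedyStep_inter]
  intro x hx
  rw [mem_arrived, not_lt, ← mem_drop_ofFn]
  exact ((List.take_sublist _ _).drop k).subset hx

theorem augment_secondPart_inter_arrived (Mi Mj : Matroid α) (T S : Finset α) (f : ℝ)
    (π : ArrivalOrder α) (k : ℕ) :
    augment Mi Mj T S (secondPart f π) ∩ arrived π k =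
      augment Mi Mj T S (((List.ofFn π).take k).drop ⌊f * (Fintype.card α : ℝ)⌋₊) ∩
        arrived π k := by
  set n := ⌊f * (Fintype.card α : ℝ)⌋₊
  have h : secondPart f π =
      ((List.ofFn π).take k).drop n ++ (List.ofFn π).drop (n + (k - n)) := by
    -- The subtraction `k - n` truncates, so the tail starts at position `max n k` and contains no
    -- arrived element.
    rw [List.drop_take, ← List.drop_drop, List.take_append_drop]
    rfl
  rw [h, augment, List.foldl_append, foldl_augmentStep_inter]
  · rfl
  intro x hx
  rw [mem_drop_ofFn] at hx
  rw [mem_arrived]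
  omega

theorem markingGreedy_isOnline (f : ℝ) (Ψ : α → Bool) :
    IsOnline (markingGreedy (α := α) f Ψ) := by
  intro k M₁ M₂ M₁' M₂' π π' hE₁ hE₂ hE₁' hE₂' hπ hind
  have h₁ : AgreeOn (arrived π k) M₁ M₁' := fun I hI => (hind I hI).1
  have h₂ : AgreeOn (arrived π k) M₂ M₂' := fun I hI => (hind I hI).2
  have hL := take_ofFn_congr hπ
  have hX : arrived π' k = arrived π k := by
    ext e
    rw [mem_arrived, mem_arrived, ← mem_take_ofFn, ← mem_take_ofFn, hL]
  have hmem : ∀ x ∈ (List.ofFn π).take k, x ∈ arrived π k := fun x hx =>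
    (mem_arrived _ _ _).2 ((mem_take_ofFn _ _ _).1 hx)
  set n := ⌊f * (Fintype.card α : ℝ)⌋₊ with hn
  have hG : greedy M₁ M₂ (((List.ofFn π).take k).take n) =
      greedy M₁' M₂' (((List.ofFn π).take k).take n) :=
    foldl_greedyStep_congr h₁ h₂ _ _ (Finset.empty_subset _)
      fun x hx => hmem x (List.mem_of_mem_take hx)
  have hS : greedy M₁ M₂ (firstPart f π) ∩ arrived π k =
      greedy M₁' M₂' (firstPart f π') ∩ arrived π k := by
    have h' := greedy_firstPart_inter_arrived M₁' M₂' f π' k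
    rw [hX, ← hL, ← hn] at h'
    rw [h', greedy_firstPart_inter_arrived, ← hn, hG]
  have hN : augment M₁ M₂ (greedy M₁ M₂ (firstPart f π))
        ((greedy M₁ M₂ (firstPart f π)).filter fun e => Ψ e = true) (secondPart f π) ∩
          arrived π k =
      augment M₁' M₂' (greedy M₁' M₂' (firstPart f π'))
        ((greedy M₁' M₂' (firstPart f π')).filter fun e => Ψ e = true) (secondPart f π') ∩
          arrived π k ∧
      augment M₂ M₁ (greedy M₁ M₂ (firstPart f π))
        ((greedy M₁ M₂ (firstPart f π)).filter fun e => Ψ e = true) (secondPart f π) ∩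
          arrived π k =
      augment M₂' M₁' (greedy M₁' M₂' (firstPart f π'))
        ((greedy M₁' M₂' (firstPart f π')).filter fun e => Ψ e = true) (secondPart f π') ∩
          arrived π k := by
    have key : ∀ (Mi Mj : Matroid α) (T S : Finset α),
        augment Mi Mj T S (secondPart f π') ∩ arrived π k =
          augment Mi Mj T S (((List.ofFn π).take k).drop n) ∩ arrived π k := by
      intro Mi Mj T S
      have h' := augment_secondPart_inter_arrived Mi Mj T S f π' k
      rwa [hX, ← hL, ← hn] at h'
    rw [key, key, augment_secondPart_inter_arrived, augment_secondPart_inter_arrived, ← hn]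
    -- Either the second phase has not begun among the first `k` arrivals, or the whole first phase
    -- lies among them and `T` is the same in both runs.
    rcases le_or_gt k n with hkn | hkn
    · have hnil : ((List.ofFn π).take k).drop n = [] :=
        List.drop_eq_nil_of_le (by simp [hkn])
      rw [hnil]
      exact ⟨rfl, rfl⟩
    · have hf : ((List.ofFn π).take k).take n = firstPart f π := by
        rw [List.take_take, min_eq_left hkn.le]; rfl
      have hf' : firstPart f π' = firstPart f π := by
        rw [← hf, hL, List.take_take, min_eq_left hkn.le]; rfl
      rw [hf] at hG
      rw [hf', ← hG]
      have hT : greedy M₁ M₂ (firstPart f π) ⊆ arrived π k := fun x hx =>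
        hmem x (List.mem_of_mem_take (hf ▸ mem_of_mem_greedy hx))
      have hl : ∀ x ∈ ((List.ofFn π).take k).drop n, x ∈ arrived π k :=
        fun x hx => hmem x (List.mem_of_mem_drop hx)
      obtain ⟨g₁, g₂⟩ := indep_greedy (M₁ := M₁) (M₂ := M₂) (firstPart f π)
      unfold augment
      rw [foldl_augmentStep_congr h₁ h₂ hE₁ hE₂ hE₁' hE₂' hT
          ((Finset.filter_subset _ _).trans hT) g₁ g₂ _ _ (Finset.empty_subset _) hl,
        foldl_augmentStep_congr h₂ h₁ hE₂ hE₁ hE₂' hE₁' hT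
          ((Finset.filter_subset _ _).trans hT) g₂ g₁ _ _ (Finset.empty_subset _) hl]
      exact ⟨rfl, rfl⟩
  rw [markingGreedy_eq, markingGreedy_eq, Finset.union_inter_distrib_right,
    Finset.union_inter_distrib_right, Finset.union_inter_distrib_right,
    Finset.union_inter_distrib_right, hN.1, hN.2, Finset.filter_inter, hS, Finset.filter_inter]

end Online

/-! ### Averages over the auxiliary bits. -/

section Bits

variable {α : Type*} [Fintype α]

theorem bitsProb_update (p : ℝ) (Ψ : α → Bool) (u : α) (b : Bool) :
    bitsProb p (Function.update Ψ u b) =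
      (if b = true then 1 - p else p) *
        ∏ e ∈ Finset.univ.erase u, if Ψ e = true then 1 - p else p := by
  unfold bitsProb
  rw [← Finset.mul_prod_erase _ _ (Finset.mem_univ u), Function.update_self]
  congr 1
  exact Finset.prod_congr rfl fun e he => by
    rw [Function.update_of_ne (Finset.ne_of_mem_erase he)]

/-- Conditioning on the bit `u`. -/
theorem sum_bitsProb_mul_split (p : ℝ) (u : α) (F : (α → Bool) → ℝ) :
    ∑ Ψ, bitsProb p Ψ * F Ψ =
      p * ∑ Ψ, bitsProb p Ψ * F (Function.update Ψ u false) +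
        (1 - p) * ∑ Ψ, bitsProb p Ψ * F (Function.update Ψ u true) := by
  rw [Finset.mul_sum, Finset.mul_sum, ← Finset.sum_add_distrib, ← sub_eq_zero,
    ← Finset.sum_sub_distrib]
  -- Flipping the bit `u` pairs the terms of the difference so that each pair cancels.
  refine Finset.sum_involution (fun Ψ _ => Function.update Ψ u (!Ψ u)) ?_ ?_ ?_ ?_
  · intro Ψ _
    have h := bitsProb_update p Ψ u (Ψ u)
    rw [Function.update_eq_self] at h
    rw [h, bitsProb_update]
    simp only [Function.update_idem]
    have h' : F Ψ = F (Function.update Ψ u (Ψ u)) := by rw [Function.update_eq_self]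
    rw [h']
    cases Ψ u <;> simp <;> ring
  · intro Ψ _ _ h
    have := congrFun h u
    simp at this
  · exact fun _ _ => Finset.mem_univ _
  · intro Ψ _
    simp

theorem sum_bitsProb (p : ℝ) : ∑ Ψ : α → Bool, bitsProb p Ψ = 1 := by
  unfold bitsProb
  rw [← Fintype.prod_sum (fun (_ : α) (b : Bool) => if b = true then 1 - p else p)]
  simp

theorem sum_bitsProb_mul_card_filter (p : ℝ) (T : Finset α) :
    ∑ Ψ : α → Bool, bitsProb p Ψ * ((T.filter fun e => Ψ e = true).card : ℝ) =
      (1 - p) * T.card := by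
  have h : ∀ e : α, ∑ Ψ : α → Bool, bitsProb p Ψ * (if Ψ e = true then 1 else 0) = 1 - p := by
    intro e
    rw [sum_bitsProb_mul_split p e]
    simp [sum_bitsProb]
  simp only [Finset.card_filter, Nat.cast_sum, Finset.mul_sum, Nat.cast_ite, Nat.cast_one,
    Nat.cast_zero]
  rw [Finset.sum_comm, Finset.sum_congr rfl fun e _ => h e, Finset.sum_const, nsmul_eq_mul,
    mul_comm]

end Bits

/-! ### The sampling lemma, by deferred revelation of the bits. -/

section Sampling

variable {α : Type*} [Fintype α] {Mi Mj : Matroid α} {T : Finset α}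

/-- With no arrivals left, the part of `I` spanned by `A ∪ N` in `Mi` has at most `|A| + |N|`
elements, and the part spanned by `T ∪ N` in `Mj` at most `|N|`, since `I` is independent over `T`
there. So `|I| ≤ |A| + 2|N|`, and `2p = (1 + p) - (1 - p)`. -/
theorem sampling_nil {p : ℝ} (h0 : 0 ≤ p) {I A U N : Finset α}
    (hEj : Mj.E = Set.univ)
    (hI : ∀ e ∈ I, e ∈ Mi.closure (T : Set α) ∧ e ∉ Mj.closure (T : Set α))
    (hIi : Mi.Indep (I : Set α)) (hIj : Mj.Indep ((T : Set α) ∪ I))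
    (hcov : ∀ e ∈ I, e ∈ Mj.closure ((T ∪ N : Finset α) : Set α) ∨
      e ∈ Mi.closure ((A ∪ N : Finset α) : Set α)) :
    p * I.card ≤ (1 + p) * ∑ Ψ : α → Bool, bitsProb p Ψ *
        ((([] : List α).foldl (augmentStep Mi Mj T (A ∪ U.filter fun e => Ψ e = true)) N).card : ℝ) +
      p * A.card - (1 - p) * N.card := by
  set I₁ := I.filter fun e => e ∈ Mi.closure ((A ∪ N : Finset α) : Set α)
  set I₂ := I.filter fun e => e ∈ Mj.closure ((T ∪ N : Finset α) : Set α)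
  have hsub : I ⊆ I₁ ∪ I₂ := by
    intro e he
    simp only [I₁, I₂, Finset.mem_union, Finset.mem_filter]
    rcases hcov e he with h | h
    · exact Or.inr ⟨he, h⟩
    · exact Or.inl ⟨he, h⟩
  have c₁ : I₁.card ≤ (A ∪ N).card :=
    card_le_of_indep_of_subset_closure
      (hIi.subset (by exact_mod_cast Finset.filter_subset _ _))
      fun e he => (Finset.mem_filter.1 he).2
  have c₂ : (T ∪ I₂).card ≤ (T ∪ N).card := by
    refine card_le_of_indep_of_subset_closure (M := Mj) (hIj.subset ?_) ?_
    · rw [Finset.coe_union]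
      exact Set.union_subset_union_right _ (by exact_mod_cast Finset.filter_subset _ _)
    · intro e he
      rcases Finset.mem_union.1 he with h | h
      · exact mem_closure_of_mem hEj (by exact_mod_cast Finset.mem_union_left _ h)
      · exact (Finset.mem_filter.1 h).2
  have hd : Disjoint T I₂ := by
    rw [Finset.disjoint_left]
    exact fun e he he' => (hI e (Finset.mem_filter.1 he').1).2
      (mem_closure_of_mem hEj (by exact_mod_cast he))
  rw [Finset.card_union_of_disjoint hd] at c₂
  have c₃ := (Finset.card_le_card hsub).trans (Finset.card_union_le _ _)
  have c₄ := Finset.card_union_le A N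
  have c₅ := Finset.card_union_le T N
  have hfin : (I.card : ℝ) ≤ A.card + 2 * N.card := by exact_mod_cast (by omega)
  have := mul_le_mul_of_nonneg_left hfin h0
  simp only [List.foldl_nil, ← Finset.sum_mul, sum_bitsProb, one_mul]
  linarith

/-- The bits of the elements of `A` have been revealed to be `1`, those of `U` are not revealed
yet, and each element of `T` whose bit turned out to be `0` has been replaced by one of `N`. -/
theorem sampling_of_revealed (hEi : Mi.E = Set.univ) (hEj : Mj.E = Set.univ) {p : ℝ}
    (h0 : 0 ≤ p) (h1 : p ≤ 1) {I : Finset α}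
    (hI : ∀ e ∈ I, e ∈ Mi.closure (T : Set α) ∧ e ∉ Mj.closure (T : Set α))
    (hIi : Mi.Indep (I : Set α)) (hIj : Mj.Indep ((T : Set α) ∪ I))
    (n : ℕ) (l : List α) (A U N : Finset α) (hn : l.length + U.card ≤ n)
    (hA : A ⊆ T) (hU : U ⊆ T) (hAU : Disjoint A U) (hNT : Disjoint N T)
    (hB : Mi.Indep (((A ∪ U ∪ N : Finset α)) : Set α))
    (hTB : (T : Set α) ⊆ Mi.closure ((A ∪ U ∪ N : Finset α) : Set α))
    (hj : Mj.Indep ((T ∪ N : Finset α) : Set α))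
    (hcov : ∀ e ∈ I, e ∈ l ∨ e ∈ Mj.closure ((T ∪ N : Finset α) : Set α) ∨
      e ∈ Mi.closure ((A ∪ N : Finset α) : Set α)) :
    p * I.card ≤ (1 + p) * ∑ Ψ : α → Bool, bitsProb p Ψ *
        ((l.foldl (augmentStep Mi Mj T (A ∪ U.filter fun e => Ψ e = true)) N).card : ℝ) +
      p * A.card - (1 - p) * N.card := by
  induction n generalizing l A U N with
  | zero =>
    have hl : l = [] := List.eq_nil_of_length_eq_zero (by omega)
    subst hl
    exact sampling_nil h0 hEj hI hIi hIj (by simpa using hcov)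
  | succ n ih =>
    rcases l with _ | ⟨e, l⟩
    · exact sampling_nil h0 hEj hI hIi hIj (by simpa using hcov)
    by_cases hskip : (e ∈ Mi.closure (T : Set α) ∧ e ∉ Mj.closure (T : Set α)) ∧
        e ∉ Mj.closure ((T ∪ N : Finset α) : Set α) ∧ e ∉ Mi.closure ((A ∪ N : Finset α) : Set α)
    · obtain ⟨⟨hei, hej⟩, hTN, hAN⟩ := hskip
      have heT : e ∉ T := fun h => hej (mem_closure_of_mem hEj (by exact_mod_cast h))
      -- `e` is spanned in `Mi` by the independent set `A ∪ U ∪ N` but not by `A ∪ N`, so its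
      -- fundamental circuit contains some `u ∈ U`. The bit of this `u` is revealed next.
      obtain ⟨u, hu, heu⟩ : ∃ u ∈ U,
          e ∉ Mi.closure (((A ∪ U ∪ N : Finset α) : Set α) \ {u}) := by
        by_contra! hcon
        have hc := mem_closure_sdiff_of_forall_mem hB
          (Mi.closure_subset_closure_of_subset_closure hTB hei) U hcon
        refine hAN (Mi.closure_subset_closure ?_ hc)
        intro x hx
        simp only [Finset.coe_union, Set.mem_sdiff, Set.mem_union, Finset.mem_coe] at hx ⊢
        tauto
      have huT := hU hu
      have huA : u ∉ A := Finset.disjoint_right.1 hAU hu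
      have huN : u ∉ N := Finset.disjoint_right.1 hNT huT
      have hne : e ≠ u := fun h => heT (h ▸ huT)
      have hBu : (((A ∪ U ∪ N : Finset α) : Set α) \ {u}) =
          ((A ∪ U.erase u ∪ N : Finset α) : Set α) := by
        ext x
        simp only [Finset.coe_union, Finset.coe_erase, Set.mem_sdiff, Set.mem_union,
          Finset.mem_coe, Set.mem_singleton_iff]
        by_cases hx : x = u
        · subst hx; simp [huA, huN]
        · simp [hx]
      rw [hBu] at heu
      have hBe : Mi.Indep (insert e ((A ∪ U.erase u ∪ N : Finset α) : Set α)) := by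
        refine indep_insert_of_notMem_closure hEi (hB.subset ?_) heu
        rw [← hBu]
        exact Set.sdiff_subset
      have hBeq : A ∪ U ∪ N = insert u (A ∪ U.erase u ∪ N) := by
        ext x
        simp only [Finset.mem_union, Finset.mem_insert, Finset.mem_erase]
        by_cases hx : x = u
        · subst hx; simp [hu]
        · simp [hx]
      have hcard : (U.erase u).card + 1 = U.card := Finset.card_erase_add_one hu
      have hlen : l.length + 1 + U.card ≤ n + 1 := by simpa using hn
      have hins : A ∪ U.erase u ∪ insert e N = insert e (A ∪ U.erase u ∪ N) :=
        Finset.union_insert _ _ _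
      have hkeepB : insert u A ∪ U.erase u ∪ N = A ∪ U ∪ N := by
        rw [hBeq, Finset.insert_union, Finset.insert_union]
      have hTN' : T ∪ insert e N = insert e (T ∪ N) := Finset.union_insert _ _ _
      -- Bit 0: exchanging `u` for `e` keeps the set independent and spanning `T`, so `e` is
      -- accepted whatever the other open bits are.
      have hdrop := ih l A (U.erase u) (insert e N) (by omega) hA
        ((Finset.erase_subset _ _).trans hU)
        (hAU.mono_right (Finset.erase_subset _ _))
        (Finset.disjoint_insert_left.2 ⟨heT, hNT⟩)
        (by rw [hins, Finset.coe_insert]; exact hBe)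
        (by
          refine hTB.trans (Mi.closure_subset_closure_of_subset_closure ?_)
          rw [hBeq, hins, Finset.coe_insert, Finset.coe_insert]
          rintro x (rfl | hx)
          · refine Matroid.mem_closure_insert heu ?_
            rw [← Finset.coe_insert, ← hBeq]
            exact Mi.closure_subset_closure_of_subset_closure hTB hei
          · exact mem_closure_of_mem hEi (Or.inr hx))
        (by
          rw [hTN', Finset.coe_insert]
          exact indep_insert_of_notMem_closure hEj hj hTN)
        (by
          intro x hx
          rw [hTN', Finset.union_insert, Finset.coe_insert, Finset.coe_insert]
          rcases hcov x hx with h | h | h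
          · rcases List.mem_cons.1 h with rfl | h
            · exact Or.inr (Or.inl (mem_closure_of_mem hEj (Set.mem_insert _ _)))
            · exact Or.inl h
          · exact Or.inr (Or.inl (Mj.closure_subset_closure (Set.subset_insert _ _) h))
          · exact Or.inr (Or.inr (Mi.closure_subset_closure (Set.subset_insert _ _) h)))
      -- Bit 1: `u` joins `A` and the same `e` is examined again. The list does not shrink, but `U`
      -- does, whence the induction on `l.length + U.card`.
      have hkeep := ih (e :: l) (insert u A) (U.erase u) N (by simp; omega)
        (Finset.insert_subset huT hA) ((Finset.erase_subset _ _).trans hU)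
        (Finset.disjoint_insert_left.2 ⟨Finset.notMem_erase _ _,
          hAU.mono_right (Finset.erase_subset _ _)⟩)
        hNT (by rw [hkeepB]; exact hB) (by rw [hkeepB]; exact hTB) hj
        (by
          intro x hx
          rcases hcov x hx with h | h | h
          · exact Or.inl h
          · exact Or.inr (Or.inl h)
          · refine Or.inr (Or.inr (Mi.closure_subset_closure ?_ h))
            rw [Finset.insert_union, Finset.coe_insert]
            exact Set.subset_insert _ _)
      have hfilter : ∀ (Ψ : α → Bool) (b : Bool),
          (U.erase u).filter (fun x => Function.update Ψ u b x = true) =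
            (U.erase u).filter (fun x => Ψ x = true) := by
        intro Ψ b
        refine Finset.filter_congr fun x hx => ?_
        rw [Function.update_of_ne (Finset.ne_of_mem_erase hx)]
      have hSf : ∀ Ψ : α → Bool, U.filter (fun x => Function.update Ψ u false x = true) =
          (U.erase u).filter (fun x => Ψ x = true) := by
        intro Ψ
        conv_lhs => rw [← Finset.insert_erase hu]
        rw [Finset.filter_insert, hfilter]
        simp
      have hSt : ∀ Ψ : α → Bool, A ∪ U.filter (fun x => Function.update Ψ u true x = true) =
          insert u A ∪ (U.erase u).filter (fun x => Ψ x = true) := by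
        intro Ψ
        conv_lhs => rw [← Finset.insert_erase hu]
        rw [Finset.filter_insert, hfilter]
        simp
      have hstep : ∀ Ψ : α → Bool, augmentStep Mi Mj T
          (A ∪ (U.erase u).filter fun x => Ψ x = true) N e = insert e N := by
        intro Ψ
        refine if_pos ⟨⟨hei, hej⟩, hBe.subset (Set.insert_subset_insert ?_), ?_⟩
        · rw [← Finset.coe_union, Finset.coe_subset]
          exact Finset.union_subset_union_left
            (Finset.union_subset_union_right (Finset.filter_subset _ _))
        · rw [← Finset.coe_union]
          exact indep_insert_of_notMem_closure hEj hj hTN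
      have heN : e ∉ N := fun h =>
        hTN (mem_closure_of_mem hEj (by exact_mod_cast Finset.mem_union_right _ h))
      rw [sum_bitsProb_mul_split p u]
      simp only [hSf, hSt]
      simp only [List.foldl_cons, hstep] at hdrop hkeep ⊢
      rw [Finset.card_insert_of_notMem heN] at hdrop
      rw [Finset.card_insert_of_notMem huA] at hkeep
      push_cast at hdrop hkeep
      -- The potential `p|A| - (1 - p)|N|` is a martingale: it falls by `1 - p` with probability `p`
      -- and rises by `p` with probability `1 - p`.
      have e1 := mul_le_mul_of_nonneg_left hdrop h0
      have e2 := mul_le_mul_of_nonneg_left hkeep (sub_nonneg.2 h1)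
      linarith
    -- Here no bit need be revealed: `e` is ineligible or blocked by `T ∪ N` or `A ∪ N`, so `N`
    -- stays unchanged for all values of the open bits.
    · have hstep : ∀ Ψ : α → Bool,
          augmentStep Mi Mj T (A ∪ U.filter fun x => Ψ x = true) N e = N := by
        intro Ψ
        unfold augmentStep
        split_ifs with h
        · obtain ⟨⟨hei, hej⟩, hi', hj'⟩ := h
          refine Finset.insert_eq_of_mem ?_
          have heT : e ∉ T := fun h => hej (mem_closure_of_mem hEj (by exact_mod_cast h))
          by_cases hTN : e ∈ Mj.closure ((T ∪ N : Finset α) : Set α)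
          · rw [Finset.coe_union] at hTN
            rcases mem_of_indep_insert_of_mem_closure hj' hTN with h | h
            · exact absurd h heT
            · exact h
          · have hAN : e ∈ Mi.closure ((A ∪ N : Finset α) : Set α) := by
              by_contra hAN
              exact hskip ⟨⟨hei, hej⟩, hTN, hAN⟩
            have hsub : ((A ∪ N : Finset α) : Set α) ⊆
                ((A ∪ U.filter fun x => Ψ x = true : Finset α) : Set α) ∪ N := by
              rw [← Finset.coe_union, Finset.coe_subset]
              exact Finset.union_subset_union_left Finset.subset_union_left
            rcases mem_of_indep_insert_of_mem_closure hi'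
              (Mi.closure_subset_closure hsub hAN) with h | h
            · exact absurd (Finset.union_subset hA ((Finset.filter_subset _ _).trans hU) h) heT
            · exact h
        · rfl
      simp only [List.foldl_cons, hstep]
      have hlen : l.length + 1 + U.card ≤ n + 1 := by simpa using hn
      refine ih l A U N (by omega) hA hU hAU hNT hB hTB hj fun x hx => ?_
      rcases hcov x hx with h | h | h
      · rcases List.mem_cons.1 h with rfl | h
        · by_contra! hcon
          exact hskip ⟨hI x hx, hcon.2⟩
        · exact Or.inl h
      · exact Or.inr (Or.inl h)
      · exact Or.inr (Or.inr h)

/-- The Greedy subroutine of Phase (b) collects, in expectation, at least a `p / (1 + p)` fraction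
of any candidate set `I` that is independent in `Mᵢ` and in `Mⱼ / T`. -/
theorem sampling (hEi : Mi.E = Set.univ) (hEj : Mj.E = Set.univ) {p : ℝ}
    (h0 : 0 ≤ p) (h1 : p ≤ 1) {I : Finset α}
    (hI : ∀ e ∈ I, e ∈ Mi.closure (T : Set α) ∧ e ∉ Mj.closure (T : Set α))
    (hIi : Mi.Indep (I : Set α)) (hIj : Mj.Indep ((T : Set α) ∪ I))
    (hTi : Mi.Indep (T : Set α)) (l : List α) (hl : ∀ e ∈ I, e ∈ l) :
    p * I.card ≤ (1 + p) * ∑ Ψ : α → Bool, bitsProb p Ψ *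
      ((augment Mi Mj T (T.filter fun e => Ψ e = true) l).card : ℝ) := by
  have h := sampling_of_revealed hEi hEj h0 h1 hI hIi hIj _ l ∅ T ∅ le_rfl
    (Finset.empty_subset _) subset_rfl (Finset.disjoint_empty_left _)
    (Finset.disjoint_empty_left _) (by simpa using hTi)
    (by simpa using Mi.subset_closure (T : Set α) (by simp [hEi]))
    (by simpa using hIj.subset Set.subset_union_left) fun e he => Or.inl (hl e he)
  simpa [augment] using h

end Sampling

/-! ### Greedy on a uniformly random order. -/

section RandomOrder

variable {α : Type*}

theorem card_filter_closure_le {M : Matroid α} {O T : Finset α} (hO : M.Indep (O : Set α)) :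
    (O.filter fun e => e ∈ M.closure (T : Set α)).card ≤ T.card :=
  card_le_of_indep_of_subset_closure (hO.subset (by exact_mod_cast Finset.filter_subset _ _))
    fun _ he => (Finset.mem_filter.1 he).2

/-- The elements of `O` that `T` spans in neither matroid. -/
noncomputable def unspanned (M₁ M₂ : Matroid α) (O T : Finset α) : Finset α :=
  O.filter fun e => e ∉ M₁.closure (T : Set α) ∧ e ∉ M₂.closure (T : Set α)

/-- Each element of `O` is counted at least twice on the right: once per spanning matroid, and if
there is only one, again as a candidate in `R` or as an element outside `R`; unspanned elements
carry weight 2. -/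
theorem two_mul_card_le {M₁ M₂ : Matroid α} (O T R : Finset α) :
    2 * O.card ≤
      (O.filter fun e => e ∈ R ∧ e ∈ M₁.closure (T : Set α) ∧ e ∉ M₂.closure (T : Set α)).card +
      (O.filter fun e => e ∈ R ∧ e ∈ M₂.closure (T : Set α) ∧ e ∉ M₁.closure (T : Set α)).card +
      (O.filter fun e => e ∈ M₁.closure (T : Set α)).card +
      (O.filter fun e => e ∈ M₂.closure (T : Set α)).card +
      2 * (unspanned M₁ M₂ O T).card + (O.filter fun e => e ∉ R).card := by
  unfold unspanned
  simp only [Finset.card_filter, Finset.mul_sum, ← Finset.sum_add_distrib]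
  rw [mul_comm, ← smul_eq_mul, ← Finset.sum_const]
  refine Finset.sum_le_sum fun e _ => ?_
  by_cases h1 : e ∈ M₁.closure (T : Set α) <;> by_cases h2 : e ∈ M₂.closure (T : Set α) <;>
    by_cases h3 : e ∈ R <;> simp [h1, h2, h3]

theorem card_le_add_card_unspanned {M₁ M₂ : Matroid α} {O T : Finset α}
    (hO₁ : M₁.Indep (O : Set α)) (hO₂ : M₂.Indep (O : Set α)) :
    O.card ≤ 2 * T.card + (unspanned M₁ M₂ O T).card := by
  have c₁ := card_filter_closure_le (T := T) hO₁
  have c₂ := card_filter_closure_le (T := T) hO₂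
  have hun : O ⊆ ((O.filter fun e => e ∈ M₁.closure (T : Set α)) ∪
      O.filter fun e => e ∈ M₂.closure (T : Set α)) ∪ unspanned M₁ M₂ O T := by
    intro e he
    simp only [unspanned, Finset.mem_union, Finset.mem_filter]
    tauto
  have a₁ := (Finset.card_le_card hun).trans (Finset.card_union_le _ _)
  have a₂ := Finset.card_union_le (O.filter fun e => e ∈ M₁.closure (T : Set α))
    (O.filter fun e => e ∈ M₂.closure (T : Set α))
  omega

variable [Fintype α]

/-- Double counting along the injection `(π, j) ↦ (π', π.symm e)`, where `π'` is obtained from `π`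
by exchanging `e` with the element in position `j`. -/
theorem card_mul_card_le_of_swap (e : α) (P Q : ArrivalOrder α → Prop)
    [DecidablePred P] [DecidablePred Q] (J K : Finset (Fin (Fintype.card α)))
    (h : ∀ π j, P π → j ∈ J → Q ((Equiv.swap j (π.symm e)).trans π) ∧ π.symm e ∈ K) :
    (Finset.univ.filter P).card * J.card ≤ (Finset.univ.filter Q).card * K.card := by
  rw [← Finset.card_product, ← Finset.card_product]
  refine Finset.card_le_card_of_injOn
    (fun x => ((Equiv.swap x.2 (x.1.symm e)).trans x.1, x.1.symm e)) ?_ ?_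
  · rintro ⟨π, j⟩ hx
    simp only [Finset.coe_product, Set.mem_prod, Finset.mem_coe, Finset.mem_filter,
      Finset.mem_univ, true_and] at hx ⊢
    exact h π j hx.1 hx.2
  · rintro ⟨π, j⟩ - ⟨π', j'⟩ - hxx
    simp only [Prod.mk.injEq] at hxx ⊢
    obtain ⟨hπ, hr⟩ := hxx
    have hj : j = j' := by
      have := congrArg (fun σ : ArrivalOrder α => σ.symm e) hπ
      simpa using this
    refine ⟨?_, hj⟩
    rw [hr, hj] at hπ
    ext i
    have := congrArg (fun σ : ArrivalOrder α => σ (Equiv.swap j' (π'.symm e) i)) hπ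
    simpa using this

theorem card_position_lt_mul_le (e : α) (k : ℕ) :
    (Finset.univ.filter fun π : ArrivalOrder α => (π.symm e : ℕ) < k).card * Fintype.card α ≤
      Fintype.card (ArrivalOrder α) * k := by
  have h := card_mul_card_le_of_swap e (fun π => (π.symm e : ℕ) < k) (fun _ => True) Finset.univ
    (Finset.univ.filter fun j => (j : ℕ) < k) (fun π j hπ _ => ⟨trivial, by simpa using hπ⟩)
  have hk : (Finset.univ.filter fun j : Fin (Fintype.card α) => (j : ℕ) < k).card ≤ k := by
    conv_rhs => rw [← Finset.card_range k]
    exact Finset.card_le_card_of_injOn (fun j => (j : ℕ)) (fun j hj => by simpa using hj)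
      (fun a _ b _ hab => Fin.ext hab)
  rw [Finset.card_univ, Fintype.card_fin, Finset.filter_true, Finset.card_univ] at h
  exact h.trans (Nat.mul_le_mul_left _ hk)

variable {M₁ M₂ : Matroid α}

/-- If `e` is not spanned after `n` steps, then Greedy picks `e` once it is moved to one of the
first `n + 1` positions. -/
theorem mem_greedy_swap (h₁ : M₁.E = Set.univ) (h₂ : M₂.E = Set.univ) (n : ℕ) (π : ArrivalOrder α)
    {e : α} (he₁ : e ∉ M₁.closure (greedy M₁ M₂ ((List.ofFn π).take n) : Set α))
    (he₂ : e ∉ M₂.closure (greedy M₁ M₂ ((List.ofFn π).take n) : Set α))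
    (j : Fin (Fintype.card α)) (hj : (j : ℕ) ≤ n) :
    e ∈ greedy M₁ M₂ (List.ofFn ((Equiv.swap j (π.symm e)).trans π : ArrivalOrder α)) := by
  have hr : n ≤ (π.symm e : ℕ) := by
    by_contra! hlt
    rcases mem_closure_greedy h₁ h₂ ((mem_take_ofFn π n e).2 hlt) with h | h
    · exact he₁ h
    · exact he₂ h
  set π' : ArrivalOrder α := (Equiv.swap j (π.symm e)).trans π with hπ'
  have htake : (List.ofFn π').take j = (List.ofFn π).take j := by
    refine take_ofFn_congr fun i hi => ?_
    rw [hπ', Equiv.trans_apply, Equiv.swap_apply_of_ne_of_ne]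
    · exact fun h => by rw [h] at hi; omega
    · exact fun h => by rw [h] at hi; omega
  have hlist : List.ofFn π' = (List.ofFn π).take j ++ e :: (List.ofFn π').drop (j + 1) := by
    conv_lhs => rw [← List.take_append_drop j (List.ofFn π'), htake]
    rw [List.drop_eq_getElem_cons (by simp)]
    simp [hπ']
  have hsub : (greedy M₁ M₂ ((List.ofFn π).take j) : Set α) ⊆
      greedy M₁ M₂ ((List.ofFn π).take n) := by
    have h : (List.ofFn π).take n = (List.ofFn π).take j ++ ((List.ofFn π).take n).drop j := by
      conv_lhs => rw [← List.take_append_drop j ((List.ofFn π).take n)]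
      rw [List.take_take, min_eq_left hj]
    rw [h]
    exact_mod_cast greedy_subset_greedy_append _ _
  rw [hlist]
  exact mem_greedy_of_notMem_closure h₁ h₂ _ _
    (fun h => he₁ (M₁.closure_subset_closure hsub h))
    (fun h => he₂ (M₂.closure_subset_closure hsub h))

theorem mul_card_unspanned_le (h₁ : M₁.E = Set.univ) (h₂ : M₂.E = Set.univ) {f : ℝ} (hf0 : 0 ≤ f)
    (hf1 : f < 1) (e : α) :
    f * (Finset.univ.filter fun π : ArrivalOrder α =>
        e ∉ M₁.closure (greedy M₁ M₂ (firstPart f π) : Set α) ∧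
        e ∉ M₂.closure (greedy M₁ M₂ (firstPart f π) : Set α)).card ≤
      (Finset.univ.filter fun π : ArrivalOrder α => e ∈ greedy M₁ M₂ (List.ofFn π)).card := by
  have hm0 : 0 < Fintype.card α := Fintype.card_pos_iff.2 ⟨e⟩
  have hm0' : (0 : ℝ) < Fintype.card α := by exact_mod_cast hm0
  set n := ⌊f * (Fintype.card α : ℝ)⌋₊ with hn
  have hnm : n < Fintype.card α := by
    rw [hn, Nat.floor_lt (by positivity)]
    nlinarith
  -- All `n + 1` positions up to index `n` are admissible targets, since at index `n` exactly the
  -- first `n` arrivals precede `e`. This extra position absorbs the rounding: `n + 1 > f m`.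
  have h := card_mul_card_le_of_swap e (fun π =>
        e ∉ M₁.closure (greedy M₁ M₂ (firstPart f π) : Set α) ∧
        e ∉ M₂.closure (greedy M₁ M₂ (firstPart f π) : Set α))
    (fun π => e ∈ greedy M₁ M₂ (List.ofFn π)) (Finset.Iic ⟨n, hnm⟩) Finset.univ
    (fun π j hπ hj => ⟨mem_greedy_swap h₁ h₂ n π hπ.1 hπ.2 j
      (by simpa [Fin.le_def] using hj), Finset.mem_univ _⟩)
  rw [Finset.card_univ, Fintype.card_fin, Fin.card_Iic] at h
  have h' : ((Finset.univ.filter fun π : ArrivalOrder α =>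
        e ∉ M₁.closure (greedy M₁ M₂ (firstPart f π) : Set α) ∧
        e ∉ M₂.closure (greedy M₁ M₂ (firstPart f π) : Set α)).card : ℝ) * ((n : ℝ) + 1) ≤
      (Finset.univ.filter fun π : ArrivalOrder α => e ∈ greedy M₁ M₂ (List.ofFn π)).card *
        Fintype.card α := by
    exact_mod_cast h
  have hfl : f * Fintype.card α < n + 1 := Nat.lt_floor_add_one _
  refine le_of_mul_le_mul_right ?_ hm0'
  refine le_trans ?_ h'
  have := mul_le_mul_of_nonneg_left hfl.le (Nat.cast_nonneg (α := ℝ)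
    (Finset.univ.filter fun π : ArrivalOrder α =>
        e ∉ M₁.closure (greedy M₁ M₂ (firstPart f π) : Set α) ∧
        e ∉ M₂.closure (greedy M₁ M₂ (firstPart f π) : Set α)).card)
  linarith

theorem sum_card_filter_comm (O : Finset α) (P : ArrivalOrder α → α → Prop)
    [∀ π e, Decidable (P π e)] :
    ∑ π : ArrivalOrder α, ((O.filter fun e => P π e).card : ℝ) =
      ∑ e ∈ O, ((Finset.univ.filter fun π : ArrivalOrder α => P π e).card : ℝ) := by
  simp only [Finset.card_filter, Nat.cast_sum]
  exact Finset.sum_comm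

theorem mul_sum_card_unspanned_le (h₁ : M₁.E = Set.univ) (h₂ : M₂.E = Set.univ) {f : ℝ}
    (hf0 : 0 ≤ f) (hf1 : f < 1) (O : Finset α) :
    f * ∑ π : ArrivalOrder α,
        ((unspanned M₁ M₂ O (greedy M₁ M₂ (firstPart f π))).card : ℝ) ≤
      ∑ π : ArrivalOrder α, ((O.filter fun e => e ∈ greedy M₁ M₂ (List.ofFn π)).card : ℝ) := by
  unfold unspanned
  rw [sum_card_filter_comm O fun π e => e ∈ greedy M₁ M₂ (List.ofFn π),
    sum_card_filter_comm O fun π e => e ∉ M₁.closure (greedy M₁ M₂ (firstPart f π) : Set α) ∧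
      e ∉ M₂.closure (greedy M₁ M₂ (firstPart f π) : Set α), Finset.mul_sum]
  exact Finset.sum_le_sum fun e _ => mul_card_unspanned_le h₁ h₂ hf0 hf1 e

theorem sum_card_early_le {f : ℝ} (hf0 : 0 ≤ f) (O : Finset α) :
    ∑ π : ArrivalOrder α, ((O.filter fun e => e ∉ secondPart f π).card : ℝ) ≤
      f * O.card * Fintype.card (ArrivalOrder α) := by
  rw [sum_card_filter_comm O fun π e => e ∉ secondPart f π]
  have h : ∀ e ∈ O, ((Finset.univ.filter fun π : ArrivalOrder α =>
      e ∉ secondPart f π).card : ℝ) ≤ f * Fintype.card (ArrivalOrder α) := by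
    intro e _
    have hm0 : (0 : ℝ) < Fintype.card α := by exact_mod_cast Fintype.card_pos_iff.2 ⟨e⟩
    have h1 := card_position_lt_mul_le e ⌊f * (Fintype.card α : ℝ)⌋₊
    have h2 : (Finset.univ.filter fun π : ArrivalOrder α => e ∉ secondPart f π) =
        Finset.univ.filter fun π : ArrivalOrder α =>
          (π.symm e : ℕ) < ⌊f * (Fintype.card α : ℝ)⌋₊ := by
      refine Finset.filter_congr fun π _ => ?_
      rw [secondPart, mem_drop_ofFn, not_le]
    rw [h2]
    have h3 : ((Finset.univ.filter fun π : ArrivalOrder α =>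
        (π.symm e : ℕ) < ⌊f * (Fintype.card α : ℝ)⌋₊).card : ℝ) * Fintype.card α ≤
      Fintype.card (ArrivalOrder α) * (⌊f * (Fintype.card α : ℝ)⌋₊ : ℝ) := by exact_mod_cast h1
    have h4 : (⌊f * (Fintype.card α : ℝ)⌋₊ : ℝ) ≤ f * Fintype.card α :=
      Nat.floor_le (by positivity)
    refine le_of_mul_le_mul_right (h3.trans ?_) hm0
    have := mul_le_mul_of_nonneg_left h4
      (Nat.cast_nonneg (α := ℝ) (Fintype.card (ArrivalOrder α)))
    linarith
  refine (Finset.sum_le_sum h).trans (le_of_eq ?_)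
  rw [Finset.sum_const, nsmul_eq_mul]
  ring

theorem card_add_card_filter_mem_greedy_le (h₁ : M₁.E = Set.univ) (h₂ : M₂.E = Set.univ)
    {O : Finset α} (hO₁ : M₁.Indep (O : Set α)) (hO₂ : M₂.Indep (O : Set α)) (π : ArrivalOrder α) :
    O.card + (O.filter fun e => e ∈ greedy M₁ M₂ (List.ofFn π)).card ≤
      2 * (greedy M₁ M₂ (List.ofFn π)).card := by
  set T := greedy M₁ M₂ (List.ofFn π)
  have c₁ := card_filter_closure_le (T := T) hO₁
  have c₂ := card_filter_closure_le (T := T) hO₂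
  have hun : O ⊆ (O.filter fun e => e ∈ M₁.closure (T : Set α)) ∪
      O.filter fun e => e ∈ M₂.closure (T : Set α) := by
    intro e he
    have hmem : e ∈ List.ofFn π := List.mem_ofFn.2 (π.surjective e)
    rcases mem_closure_greedy h₁ h₂ hmem with h | h
    · exact Finset.mem_union_left _ (Finset.mem_filter.2 ⟨he, h⟩)
    · exact Finset.mem_union_right _ (Finset.mem_filter.2 ⟨he, h⟩)
  have hint : (O.filter fun e => e ∈ T) ⊆ (O.filter fun e => e ∈ M₁.closure (T : Set α)) ∩
      O.filter fun e => e ∈ M₂.closure (T : Set α) := by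
    intro e he
    obtain ⟨heO, heT⟩ := Finset.mem_filter.1 he
    have heT' : e ∈ (T : Set α) := by exact_mod_cast heT
    exact Finset.mem_inter.2 ⟨Finset.mem_filter.2 ⟨heO, mem_closure_of_mem h₁ heT'⟩,
      Finset.mem_filter.2 ⟨heO, mem_closure_of_mem h₂ heT'⟩⟩
  have a₁ := Finset.card_le_card hun
  have a₂ := Finset.card_le_card hint
  have a₃ := Finset.card_union_add_card_inter (O.filter fun e => e ∈ M₁.closure (T : Set α))
    (O.filter fun e => e ∈ M₂.closure (T : Set α))
  omega

end RandomOrder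

/-! ### Combining the estimates. -/

section Main

variable {α : Type*} [Fintype α]

/-- Take `I = X ∩ J`, with `X` the eligible elements of `O` and `J ⊆ O` an augmentation of `T` of
size at least `|O| - |T|`. Both avoid the span of `T` in `Mj`, which bounds `|X ∪ J|`. -/
theorem exists_candidates {Mi Mj : Matroid α} (hEj : Mj.E = Set.univ) {T O R : Finset α}
    (hT : Mj.Indep (T : Set α)) (hO : Mj.Indep (O : Set α)) :
    ∃ I ⊆ O, (∀ e ∈ I, e ∈ R ∧ e ∈ Mi.closure (T : Set α) ∧ e ∉ Mj.closure (T : Set α)) ∧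
      Mj.Indep ((T : Set α) ∪ I) ∧
      (O.filter fun e => e ∈ R ∧ e ∈ Mi.closure (T : Set α) ∧ e ∉ Mj.closure (T : Set α)).card +
        (O.filter fun e => e ∈ Mj.closure (T : Set α)).card ≤ I.card + T.card := by
  obtain ⟨J, hJO, hJT, hJ, hc⟩ := exists_indep_augmentation hEj hT hO
  set X := O.filter fun e => e ∈ R ∧ e ∈ Mi.closure (T : Set α) ∧ e ∉ Mj.closure (T : Set α)
    with hX
  refine ⟨X ∩ J, fun e he => hJO (Finset.mem_inter.1 he).2,
    fun e he => (Finset.mem_filter.1 (Finset.mem_inter.1 he).1).2,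
    hJ.subset (Set.union_subset_union_right _ (by exact_mod_cast Finset.inter_subset_right)), ?_⟩
  have h1 := Finset.card_union_add_card_inter X J
  have h2 : (X ∪ J).card + (O.filter fun e => e ∈ Mj.closure (T : Set α)).card ≤ O.card := by
    rw [← Finset.card_union_of_disjoint]
    · refine Finset.card_le_card (Finset.union_subset (Finset.union_subset ?_ hJO) ?_)
      · exact Finset.filter_subset _ _
      · exact Finset.filter_subset _ _
    · rw [Finset.disjoint_left]
      intro e he he'
      rcases Finset.mem_union.1 he with h | h
      · exact (Finset.mem_filter.1 h).2.2.2 (Finset.mem_filter.1 he').2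
      · exact hJT e h (Finset.mem_filter.1 he').2
  omega

/-- The expected output size for a fixed arrival order. -/
theorem le_sum_card_markingGreedy {M₁ M₂ : Matroid α} (h₁ : M₁.E = Set.univ)
    (h₂ : M₂.E = Set.univ) {O : Finset α} (hO₁ : M₁.Indep (O : Set α))
    (hO₂ : M₂.Indep (O : Set α)) (f : ℝ) {p : ℝ} (h0 : 0 ≤ p) (hp1 : p ≤ 1)
    (π : ArrivalOrder α) :
    (1 - p - 2 * (p / (1 + p))) * (greedy M₁ M₂ (firstPart f π)).card +
      p / (1 + p) * (2 * O.card -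
        2 * (unspanned M₁ M₂ O (greedy M₁ M₂ (firstPart f π))).card -
        (O.filter fun e => e ∉ secondPart f π).card) ≤
      ∑ Ψ : α → Bool, bitsProb p Ψ * ((markingGreedy f Ψ M₁ M₂ π).card : ℝ) := by
  set T := greedy M₁ M₂ (firstPart f π) with hT
  set l := secondPart f π with hl
  obtain ⟨g₁, g₂⟩ := indep_greedy (M₁ := M₁) (M₂ := M₂) (firstPart f π)
  rw [← hT] at g₁ g₂
  obtain ⟨I₁, hI₁O, hI₁, hI₁T, c₁⟩ :=
    exists_candidates (Mi := M₁) (R := l.toFinset) h₂ g₂ hO₂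
  obtain ⟨I₂, hI₂O, hI₂, hI₂T, c₂⟩ :=
    exists_candidates (Mi := M₂) (R := l.toFinset) h₁ g₁ hO₁
  have s₁ := sampling h₁ h₂ h0 hp1 (fun e he => (hI₁ e he).2)
    (hO₁.subset (by exact_mod_cast hI₁O)) hI₁T g₁ l fun e he => List.mem_toFinset.1 (hI₁ e he).1
  have s₂ := sampling h₂ h₁ h0 hp1 (fun e he => (hI₂ e he).2)
    (hO₂.subset (by exact_mod_cast hI₂O)) hI₂T g₂ l fun e he => List.mem_toFinset.1 (hI₂ e he).1
  have hcount := two_mul_card_le (M₁ := M₁) (M₂ := M₂) O T l.toFinset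
  simp only [List.mem_toFinset] at hcount c₁ c₂
  have hII : (2 * O.card : ℝ) ≤ I₁.card + I₂.card + 2 * T.card +
      2 * (unspanned M₁ M₂ O T).card + (O.filter fun e => e ∉ l).card := by
    exact_mod_cast (by omega)
  have hsum : ∑ Ψ : α → Bool, bitsProb p Ψ * ((markingGreedy f Ψ M₁ M₂ π).card : ℝ) =
      (1 - p) * T.card +
        ∑ Ψ : α → Bool, bitsProb p Ψ *
          ((augment M₁ M₂ T (T.filter fun e => Ψ e = true) l).card : ℝ) +
        ∑ Ψ : α → Bool, bitsProb p Ψ *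
          ((augment M₂ M₁ T (T.filter fun e => Ψ e = true) l).card : ℝ) := by
    rw [← sum_bitsProb_mul_card_filter, ← Finset.sum_add_distrib, ← Finset.sum_add_distrib]
    refine Finset.sum_congr rfl fun Ψ _ => ?_
    rw [markingGreedy_eq, card_union_augment h₁ h₂ (Finset.filter_subset _ _) g₁ g₂]
    push_cast
    ring
  have hp : 0 < 1 + p := by linarith
  rw [mul_comm (1 + p), ← div_le_iff₀ hp, mul_comm p, mul_div_assoc, mul_comm] at s₁ s₂
  have := mul_le_mul_of_nonneg_left hII (div_nonneg h0 hp.le)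
  rw [hsum]
  linarith

theorem sum_card_greedy_le {M₁ M₂ : Matroid α} {O : Finset α} (hO : IsMaxCommonIndep M₁ M₂ O)
    {x : ℝ} (hG : greedyRatio M₁ M₂ O 1 ≤ x) :
    ∑ π : ArrivalOrder α, ((greedy M₁ M₂ (List.ofFn π)).card : ℝ) ≤
      x * O.card * Fintype.card (ArrivalOrder α) := by
  have hP : (0 : ℝ) < Fintype.card (ArrivalOrder α) := by
    exact_mod_cast Fintype.card_pos_iff.2 ⟨(Fintype.equivFin α).symm⟩
  rcases Nat.eq_zero_or_pos O.card with h | h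
  -- If `O` is empty, the ratio is the default value of division by zero and says nothing;
  -- maximality of `O` makes Greedy empty.
  · have hz : ∀ π : ArrivalOrder α, (greedy M₁ M₂ (List.ofFn π)).card = 0 := fun π =>
      Nat.le_zero.1 (h ▸ hO.2 _ (indep_greedy _).1 (indep_greedy _).2)
    simp [hz, h]
  · have hfull : ∀ π : ArrivalOrder α, firstPart 1 π = List.ofFn π := by
      intro π
      simp [firstPart]
    have hc : (0 : ℝ) < O.card := by exact_mod_cast h
    unfold greedyRatio at hG
    rw [div_le_iff₀ hc, Finset.expect_eq_sum_div_card, Finset.card_univ, div_le_iff₀ hP] at hG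
    simpa only [hfull] using hG

theorem le_markingGreedyExpectedSize {M₁ M₂ : Matroid α} (h₁ : M₁.E = Set.univ)
    (h₂ : M₂.E = Set.univ) {O : Finset α} (hO : IsMaxCommonIndep M₁ M₂ O) {ε f p : ℝ}
    (hf0 : 0 < f) (hf1 : f < 1) (h0 : 0 ≤ p) (hp1 : p ≤ 1)
    (hp : 0 ≤ 1 - p - 2 * (p / (1 + p))) (hG : greedyRatio M₁ M₂ O 1 ≤ 1 / 2 + ε) :
    ((1 - p - 2 * (p / (1 + p))) * (1 / 2 - ε / f) + p / (1 + p) * (2 - 4 * (ε / f) - f)) *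
      O.card ≤ markingGreedyExpectedSize M₁ M₂ f p := by
  have hP : (0 : ℝ) < Fintype.card (ArrivalOrder α) := by
    exact_mod_cast Fintype.card_pos_iff.2 ⟨(Fintype.equivFin α).symm⟩
  have hT := sum_card_greedy_le hO hG
  obtain ⟨⟨hO₁, hO₂⟩, -⟩ := hO
  have hover : ∑ π : ArrivalOrder α, ((O.card : ℝ) +
      (O.filter fun e => e ∈ greedy M₁ M₂ (List.ofFn π)).card) ≤
      ∑ π : ArrivalOrder α, 2 * ((greedy M₁ M₂ (List.ofFn π)).card : ℝ) :=
    Finset.sum_le_sum fun π _ => by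
      exact_mod_cast card_add_card_filter_mem_greedy_le h₁ h₂ hO₁ hO₂ π
  rw [Finset.sum_add_distrib, Finset.sum_const, Finset.card_univ, nsmul_eq_mul,
    ← Finset.mul_sum] at hover
  have hun := mul_sum_card_unspanned_le h₁ h₂ hf0.le hf1 O
  have hearly := sum_card_early_le hf0.le O
  set c := p / (1 + p) with hc
  have hc0 : 0 ≤ c := by positivity
  set U := ∑ π : ArrivalOrder α,
    ((unspanned M₁ M₂ O (greedy M₁ M₂ (firstPart f π))).card : ℝ) with hU
  set F := ∑ π : ArrivalOrder α, ((O.filter fun e => e ∉ secondPart f π).card : ℝ) with hF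
  have hUle : U ≤ 2 * (ε / f) * O.card * Fintype.card (ArrivalOrder α) := by
    have : U ≤ 2 * ε * O.card * Fintype.card (ArrivalOrder α) / f := by
      rw [le_div_iff₀ hf0]
      linarith
    refine this.trans (le_of_eq ?_)
    ring
  have hmain : ∑ π : ArrivalOrder α, ((1 - p - 2 * c) * ((O.card -
        (unspanned M₁ M₂ O (greedy M₁ M₂ (firstPart f π))).card) / 2) +
      c * (2 * O.card - 2 * (unspanned M₁ M₂ O (greedy M₁ M₂ (firstPart f π))).card -
        (O.filter fun e => e ∉ secondPart f π).card)) ≤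
      ∑ π : ArrivalOrder α, ∑ Ψ : α → Bool,
        bitsProb p Ψ * ((markingGreedy f Ψ M₁ M₂ π).card : ℝ) := by
    refine Finset.sum_le_sum fun π _ =>
      le_trans ?_ (le_sum_card_markingGreedy h₁ h₂ hO₁ hO₂ f h0 hp1 π)
    have h : (O.card : ℝ) ≤ 2 * (greedy M₁ M₂ (firstPart f π)).card +
        (unspanned M₁ M₂ O (greedy M₁ M₂ (firstPart f π))).card := by
      exact_mod_cast card_le_add_card_unspanned hO₁ hO₂
    have h' : ((O.card : ℝ) - (unspanned M₁ M₂ O (greedy M₁ M₂ (firstPart f π))).card) / 2 ≤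
        (greedy M₁ M₂ (firstPart f π)).card := by linarith
    -- The lower bound on `|T|` may be inserted because its coefficient `1 - p - 2c` is nonnegative,
    -- which for `p ≥ 0` means `p ≤ √2 - 1`.
    have := mul_le_mul_of_nonneg_left h' hp
    linarith
  simp only [Finset.sum_add_distrib, ← Finset.mul_sum, Finset.sum_sub_distrib,
    ← Finset.sum_div, Finset.sum_const, Finset.card_univ, nsmul_eq_mul] at hmain
  rw [← hU, ← hF] at hmain
  unfold markingGreedyExpectedSize
  rw [Finset.expect_eq_sum_div_card, Finset.card_univ, le_div_iff₀ hP]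
  refine le_trans ?_ hmain
  have e₁ := mul_le_mul_of_nonneg_left hUle hp
  have e₂ := mul_le_mul_of_nonneg_left hUle hc0
  have e₃ := mul_le_mul_of_nonneg_left hearly hc0
  linarith

end Main

end OnlineMatroidIntersection

theorem mainTheorem4 :
    ∃ ε γ f p : ℝ, ε = 0.001 ∧ 0.03 ≤ γ ∧ f = 0.05 ∧ p = 0.33 ∧
      ∀ (α : Type*) [Fintype α],
        (∀ Ψ : α → Bool,
          OnlineMatroidIntersection.IsOnline (OnlineMatroidIntersection.markingGreedy f Ψ)) ∧
        ∀ (M₁ M₂ : Matroid α) (O : Finset α), M₁.E = Set.univ → M₂.E = Set.univ →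
          OnlineMatroidIntersection.IsMaxCommonIndep M₁ M₂ O →
          OnlineMatroidIntersection.greedyRatio M₁ M₂ O 1 ≤ 1 / 2 + ε →
          (∀ (π : OnlineMatroidIntersection.ArrivalOrder α) (Ψ : α → Bool),
            M₁.Indep (OnlineMatroidIntersection.markingGreedy f Ψ M₁ M₂ π : Set α) ∧
            M₂.Indep (OnlineMatroidIntersection.markingGreedy f Ψ M₁ M₂ π : Set α)) ∧
          (1 / 2 + γ) * (O.card : ℝ) ≤
            OnlineMatroidIntersection.markingGreedyExpectedSize M₁ M₂ f p := by
  refine ⟨0.001, 0.03, 0.05, 0.33, rfl, le_rfl, rfl, rfl, fun α _ =>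
    ⟨OnlineMatroidIntersection.markingGreedy_isOnline _, fun M₁ M₂ O h₁ h₂ hO hG =>
      ⟨fun π Ψ => OnlineMatroidIntersection.markingGreedy_indep h₁ h₂ _ Ψ π, ?_⟩⟩⟩
  -- With these parameters `ε / f = 0.02`, and the coefficient is about `0.547`, above the required
  -- `0.53`.
  refine le_trans (mul_le_mul_of_nonneg_right ?_ (Nat.cast_nonneg _))
    (OnlineMatroidIntersection.le_markingGreedyExpectedSize h₁ h₂ hO (by norm_num) (by norm_num)
      (by norm_num) (by norm_num) (by norm_num) hG)
  norm_num
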